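/- For probability measures $\alpha,\beta$ on $\mathbb{R}^d$ let $W_2^2(\alpha,\beta)=\inf_{\gamma}\int\|x-y\|_2^2\,d\gamma(x,y)\in[0,\infty]$, where $\gamma$ runs over the couplings of $\alpha$ and $\beta$; a coupling that attains this infimum is an optimal plan from $\alpha$ to $\beta$. For $t\in[0,1]$ put $P_t(x,y)=(1-t)x+ty$; the McCann interpolation along a plan $\pi$ is the family $((P_t)_\#\pi)_{t\in[0,1]}$. Let $M(\mu,\nu)$ be the set of pairs $(\tilde\mu,\tilde\nu)$ of probability measures for which there are an optimal plan $\gamma$ from $\mu$ to $\nu$, an optimal plan $\tilde\gamma$ from $\tilde\mu$ to $\tilde\nu$ and an interval $[a,b]\subset[0,1]$ such that for every $t\in[0,1]$ there is an $s\in[a,b]$ with $(P_s)_\#\tilde\gamma=(P_t)_\#\gamma$. For measures $\mathcal{D}_1,\dots,\mathcal{D}_m$ (atoms), $\mu_1,\dots,\mu_n$ (data) and coefficient vectors $\boldsymbol\lambda_1,\dots,\boldsymbol\lambda_n$ in the probability simplex of $\mathbb{R}^m$, the geometric sparse regularizer is $\sum_{i=1}^n\sum_{j=1}^m(\boldsymbol\lambda_i)_j\,W_2^2(\mathcal{D}_j,\mu_i)$.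 **Theorem.** Let $\mu,\nu,\tilde\nu$ be probability measures on $\mathbb{R}^d$ with $W_2(\mu,\tilde\nu)<\infty$ (for instance, with finite second moments), let $\pi$ be an optimal plan from $\mu$ to $\nu$ and $\tilde\pi$ an optimal plan from $\mu$ to $\tilde\nu$, and suppose $(\mu,\tilde\nu)\in M(\mu,\nu)$. If $t,s\in[0,1]$ and $\mu_t=(P_t)_\#\pi=(P_s)_\#\tilde\pi$, then $$(1-t)W_2^2(\mu,\mu_t)+tW_2^2(\nu,\mu_t)\le(1-s)W_2^2(\mu,\mu_t)+sW_2^2(\tilde\nu,\mu_t).$$ That is, for the single data point $\mu_t$, the geometric sparse regularizer of the atoms $\mu,\nu$ with coefficients $(1-t,t)$ is at most that of the atoms $\mu,\tilde\nu$ with coefficients $(1-s,s)$. -/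

import Mathlib

open MeasureTheory Set
open scoped ENNReal

noncomputable section

/-- `π` is a joint distribution on `ℝᵈ × ℝᵈ` with marginals `μ` and `ν`. -/
def IsCoupling {d : ℕ} (μ ν : Measure (EuclideanSpace ℝ (Fin d)))
    (π : Measure (EuclideanSpace ℝ (Fin d) × EuclideanSpace ℝ (Fin d))) : Prop :=
  π.fst = μ ∧ π.snd = ν

/-- The quadratic transport cost `∫ ‖x - y‖² dπ(x, y)`, with values in `[0, ∞]`. -/
def transportCost {d : ℕ}
    (π : Measure (EuclideanSpace ℝ (Fin d) × EuclideanSpace ℝ (Fin d))) : ℝ≥0∞ :=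
  ∫⁻ z, ‖z.1 - z.2‖ₑ ^ 2 ∂π

/-- The squared Wasserstein-2 distance, with values in `[0, ∞]`. -/
def W2sq {d : ℕ} (μ ν : Measure (EuclideanSpace ℝ (Fin d))) : ℝ≥0∞ :=
  ⨅ (π : Measure (EuclideanSpace ℝ (Fin d) × EuclideanSpace ℝ (Fin d)))
    (_ : IsCoupling μ ν π), transportCost π

/-- `π` is an optimal transport plan from `μ` to `ν`: a coupling that attains the infimum. -/
def IsOptimalPlan {d : ℕ} (μ ν : Measure (EuclideanSpace ℝ (Fin d)))
    (π : Measure (EuclideanSpace ℝ (Fin d) × EuclideanSpace ℝ (Fin d))) : Prop :=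
  IsCoupling μ ν π ∧ transportCost π = W2sq μ ν

/-- The point `(P_t)_# π` of the McCann interpolation, where `P_t(x, y) = (1 - t) x + t y`. -/
def mccann {d : ℕ} (π : Measure (EuclideanSpace ℝ (Fin d) × EuclideanSpace ℝ (Fin d)))
    (t : ℝ) : Measure (EuclideanSpace ℝ (Fin d)) :=
  π.map (fun z => (1 - t) • z.1 + t • z.2)

/-- The McCann interpolation along `π'` contains the one along `π`: there is an interval
`[a, b] ⊆ [0, 1]` such that every `(P_t)_# π`, `t ∈ [0, 1]`, is `(P_s)_# π'` for an
`s ∈ [a, b]`. -/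
def ContainsMcCann {d : ℕ}
    (π' π : Measure (EuclideanSpace ℝ (Fin d) × EuclideanSpace ℝ (Fin d))) : Prop :=
  ∃ a b : ℝ, 0 ≤ a ∧ a ≤ b ∧ b ≤ 1 ∧
    ∀ t ∈ Icc (0 : ℝ) 1, ∃ s ∈ Icc a b, mccann π' s = mccann π t

/-- The set `M(μ, ν)` of all pairs of probability measures that contain a McCann interpolation
between `μ` and `ν`. -/
def mccannExtensions {d : ℕ} (μ ν : Measure (EuclideanSpace ℝ (Fin d))) :
    Set (Measure (EuclideanSpace ℝ (Fin d)) × Measure (EuclideanSpace ℝ (Fin d))) :=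
  {p | IsProbabilityMeasure p.1 ∧ IsProbabilityMeasure p.2 ∧
    ∃ π π' : Measure (EuclideanSpace ℝ (Fin d) × EuclideanSpace ℝ (Fin d)),
      IsOptimalPlan μ ν π ∧ IsOptimalPlan p.1 p.2 π' ∧ ContainsMcCann π' π}

/-- The geometric sparse regularizer `∑ᵢ ∑ⱼ (λᵢ)ⱼ W₂²(𝒟ⱼ, μᵢ)` of a dictionary `D` of `m`
measures, with coefficient vectors `Λ i` in the probability simplex, for the data `X`. -/
def geometricSparseRegularizer {d m n : ℕ} (D : Fin m → Measure (EuclideanSpace ℝ (Fin d)))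
    (Λ : Fin n → stdSimplex ℝ (Fin m)) (X : Fin n → Measure (EuclideanSpace ℝ (Fin d))) :
    ℝ≥0∞ :=
  ∑ i, ∑ j, ENNReal.ofReal ((Λ i).1 j) * W2sq (D j) (X i)

/-- The coefficient vector `(1 - t, t)`, for `t ∈ [0, 1]`. -/
def pairWeights (t : Icc (0 : ℝ) 1) : stdSimplex ℝ (Fin 2) :=
  ⟨![1 - t.1, t.1], by
    refine ⟨fun j => ?_, by simp⟩
    fin_cases j
    · simpa using t.2.2
    · simpa using t.2.1⟩

end

/-!
Write `A = W₂²(μ, ν)` and `B = W₂²(μ, ν')`. Everything rests on two estimates for `W₂²`.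

* Upper bound (`W2sq_mccann_le`): pushing a plan `π` forward under `(P_a, P_b)` gives a coupling of
  `(P_a)_# π` and `(P_b)_# π` whose cost is `(b - a)²` times that of `π`.
* Lower bound (`convex_W2sq_le`): gluing couplings along a common marginal `ρ` and integrating
  `s (1 - s) ‖x - z‖² ≤ (1 - s) ‖x - y‖² + s ‖z - y‖²` gives
  `s (1 - s) W₂²(μ, ν) ≤ (1 - s) W₂²(μ, ρ) + s W₂²(ν, ρ)`. It plays the role of the triangle
  inequality for `W₂`.

Together they show that `W₂²(μ, (P_t)_# π) = t² W₂²(μ, ν)` for an optimal plan `π` of finite cost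
(`IsOptimalPlan.W2sq_mccann_right`), so the two descriptions of `μ_t` yield `t² A = s² B`. Since
`(μ, ν')` contains an interpolation from `μ` to `ν`, the upper bound also gives `A ≤ B`
(`W2sq_le_of_mem_mccannExtensions`), whence `t A ≤ s B`. The left-hand side is then at most
`t (1 - t) A = t A - t² A ≤ s B - s² B = s (1 - s) B`, which the lower bound with `ρ = μ_t` bounds
by the right-hand side.
-/

open ProbabilityTheory

theorem measurable_mccann_map {d : ℕ} (t : ℝ) :
    Measurable (fun z : EuclideanSpace ℝ (Fin d) × EuclideanSpace ℝ (Fin d) =>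
      (1 - t) • z.1 + t • z.2) := by
  fun_prop

theorem IsCoupling.isProbabilityMeasure {d : ℕ} {μ ν : Measure (EuclideanSpace ℝ (Fin d))}
    {π : Measure (EuclideanSpace ℝ (Fin d) × EuclideanSpace ℝ (Fin d))}
    [IsProbabilityMeasure μ] (h : IsCoupling μ ν π) : IsProbabilityMeasure π :=
  ⟨by rw [← Measure.fst_univ, h.1, measure_univ]⟩

theorem mccann_zero {d : ℕ} (π : Measure (EuclideanSpace ℝ (Fin d) × EuclideanSpace ℝ (Fin d))) :
    mccann π 0 = π.fst := by
  simp [mccann, Measure.fst]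

theorem mccann_one {d : ℕ} (π : Measure (EuclideanSpace ℝ (Fin d) × EuclideanSpace ℝ (Fin d))) :
    mccann π 1 = π.snd := by
  simp [mccann, Measure.snd]

theorem W2sq_le_transportCost {d : ℕ} {μ ν : Measure (EuclideanSpace ℝ (Fin d))}
    {π : Measure (EuclideanSpace ℝ (Fin d) × EuclideanSpace ℝ (Fin d))} (h : IsCoupling μ ν π) :
    W2sq μ ν ≤ transportCost π :=
  iInf₂_le π h

theorem measurable_transport_integrand {d : ℕ} :
    Measurable (fun z : EuclideanSpace ℝ (Fin d) × EuclideanSpace ℝ (Fin d) =>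
      ‖z.1 - z.2‖ₑ ^ 2) := by
  fun_prop

theorem enorm_sq_eq_ofReal {E : Type*} [SeminormedAddCommGroup E] (x : E) :
    ‖x‖ₑ ^ 2 = ENNReal.ofReal (‖x‖ ^ 2) := by
  rw [← ofReal_norm, ENNReal.ofReal_pow (norm_nonneg x)]

theorem W2sq_mccann_le {d : ℕ}
    (π : Measure (EuclideanSpace ℝ (Fin d) × EuclideanSpace ℝ (Fin d))) (a b : ℝ) :
    W2sq (mccann π a) (mccann π b) ≤ ENNReal.ofReal ((b - a) ^ 2) * transportCost π := by
  have hm := (measurable_mccann_map (d := d) a).prodMk (measurable_mccann_map (d := d) b)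
  refine (W2sq_le_transportCost (π := π.map _)
    ⟨Measure.fst_map_prodMk (measurable_mccann_map b),
      Measure.snd_map_prodMk (measurable_mccann_map a)⟩).trans_eq ?_
  unfold transportCost
  rw [lintegral_map measurable_transport_integrand hm,
    ← lintegral_const_mul _ measurable_transport_integrand]
  refine lintegral_congr fun z => ?_
  have h : ((1 - a) • z.1 + a • z.2) - ((1 - b) • z.1 + b • z.2) = (b - a) • (z.1 - z.2) := by
    module
  rw [h, enorm_sq_eq_ofReal, enorm_sq_eq_ofReal, norm_smul, mul_pow, Real.norm_eq_abs, sq_abs,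
    ENNReal.ofReal_mul (sq_nonneg _)]

theorem convex_sq_norm_sub_le {E : Type*} [NormedAddCommGroup E] [InnerProductSpace ℝ E] (s : ℝ)
    (x y z : E) :
    s * (1 - s) * ‖x - z‖ ^ 2 ≤ (1 - s) * ‖x - y‖ ^ 2 + s * ‖z - y‖ ^ 2 := by
  -- The difference of the two sides is the squared distance of `y` to the point `(1 - s) x + s z`.
  have h := sq_nonneg ‖(1 - s) • (x - y) + s • (z - y)‖
  have e : x - z = (x - y) - (z - y) := by abel
  rw [norm_add_sq_real, norm_smul, norm_smul, inner_smul_left, inner_smul_right, mul_pow, mul_pow,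
    Real.norm_eq_abs, Real.norm_eq_abs, sq_abs, sq_abs] at h
  rw [e, norm_sub_sq_real]
  simp only [conj_trivial] at h
  linarith

/-- Gluing: two measures with the same second marginal are marginals of a measure
on the triple product, whose first factor carries the shared marginal. -/
theorem exists_gluing {X Y Z : Type*} [MeasurableSpace X] [StandardBorelSpace X] [Nonempty X]
    [MeasurableSpace Y] [MeasurableSpace Z] [StandardBorelSpace Z] [Nonempty Z]
    (σ₁ : Measure (X × Y)) (σ₂ : Measure (Z × Y)) [IsFiniteMeasure σ₁] [IsFiniteMeasure σ₂]
    (h : σ₁.snd = σ₂.snd) :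
    ∃ τ : Measure (Y × X × Z),
      τ.map (fun w => (w.2.1, w.1)) = σ₁ ∧ τ.map (fun w => (w.2.2, w.1)) = σ₂ := by
  -- Disintegrate both measures over the shared marginal and make the two conditional laws
  -- independent.
  set k₁ := (σ₁.map Prod.swap).condKernel
  set k₂ := (σ₂.map Prod.swap).condKernel
  have h₁ : σ₁.snd ⊗ₘ k₁ = σ₁.map Prod.swap := by
    have := (σ₁.map Prod.swap).disintegrate k₁
    rwa [Measure.fst_map_swap] at this
  have h₂ : σ₁.snd ⊗ₘ k₂ = σ₂.map Prod.swap := by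
    have := (σ₂.map Prod.swap).disintegrate k₂
    rwa [Measure.fst_map_swap, ← h] at this
  refine ⟨σ₁.snd ⊗ₘ (k₁ ×ₖ k₂), ?_, ?_⟩
  · have : (σ₁.snd ⊗ₘ (k₁ ×ₖ k₂)).map (Prod.map id Prod.fst) = σ₁.map Prod.swap := by
      rw [← Measure.compProd_map measurable_fst, ← Kernel.fst_eq, Kernel.fst_prod, h₁]
    have e := congrArg (Measure.map Prod.swap) this
    rw [Measure.map_map (by fun_prop) (by fun_prop), Measure.map_map (by fun_prop) (by fun_prop),
      Prod.swap_swap_eq, Measure.map_id] at e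
    exact e
  · have : (σ₁.snd ⊗ₘ (k₁ ×ₖ k₂)).map (Prod.map id Prod.snd) = σ₂.map Prod.swap := by
      rw [← Measure.compProd_map measurable_snd, ← Kernel.snd_eq, Kernel.snd_prod, h₂]
    have e := congrArg (Measure.map Prod.swap) this
    rw [Measure.map_map (by fun_prop) (by fun_prop), Measure.map_map (by fun_prop) (by fun_prop),
      Prod.swap_swap_eq, Measure.map_id] at e
    exact e

theorem convex_W2sq_le_transportCost {d : ℕ} {μ ν ρ : Measure (EuclideanSpace ℝ (Fin d))}
    [IsProbabilityMeasure μ] [IsProbabilityMeasure ν] {s : ℝ} (hs : s ∈ Icc (0 : ℝ) 1)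
    {σ₁ σ₂ : Measure (EuclideanSpace ℝ (Fin d) × EuclideanSpace ℝ (Fin d))}
    (h₁ : IsCoupling μ ρ σ₁) (h₂ : IsCoupling ν ρ σ₂) :
    ENNReal.ofReal (s * (1 - s)) * W2sq μ ν ≤
      ENNReal.ofReal (1 - s) * transportCost σ₁ + ENNReal.ofReal s * transportCost σ₂ := by
  have := h₁.isProbabilityMeasure
  have := h₂.isProbabilityMeasure
  obtain ⟨τ, rfl, rfl⟩ := exists_gluing σ₁ σ₂ (h₁.2.trans h₂.2.symm)
  have hc : IsCoupling μ ν (τ.map Prod.snd) := by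
    refine ⟨?_, ?_⟩
    · rw [← h₁.1, Measure.fst, Measure.fst, Measure.map_map (by fun_prop) (by fun_prop),
        Measure.map_map (by fun_prop) (by fun_prop)]
      rfl
    · rw [← h₂.1, Measure.snd, Measure.fst, Measure.map_map (by fun_prop) (by fun_prop),
        Measure.map_map (by fun_prop) (by fun_prop)]
      rfl
  refine (mul_le_mul_right (W2sq_le_transportCost hc) _).trans ?_
  unfold transportCost
  rw [lintegral_map measurable_transport_integrand (by fun_prop),
    lintegral_map measurable_transport_integrand (by fun_prop),
    lintegral_map measurable_transport_integrand (by fun_prop),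
    ← lintegral_const_mul _ (by fun_prop), ← lintegral_const_mul _ (by fun_prop),
    ← lintegral_const_mul _ (by fun_prop), ← lintegral_add_left (by fun_prop)]
  refine lintegral_mono fun w => ?_
  have hs' : 0 ≤ 1 - s := sub_nonneg.2 hs.2
  simp only [enorm_sq_eq_ofReal]
  rw [← ENNReal.ofReal_mul (mul_nonneg hs.1 hs'), ← ENNReal.ofReal_mul hs',
    ← ENNReal.ofReal_mul hs.1,
    ← ENNReal.ofReal_add (mul_nonneg hs' (sq_nonneg _)) (mul_nonneg hs.1 (sq_nonneg _))]
  exact ENNReal.ofReal_le_ofReal (convex_sq_norm_sub_le s w.2.1 w.1 w.2.2)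

/-- A quadratic substitute for the triangle inequality: divided by `s (1 - s)` and minimized
over `0 < s < 1`, it gives `W₂(μ, ν) ≤ W₂(μ, ρ) + W₂(ν, ρ)`. -/
theorem convex_W2sq_le {d : ℕ} (μ ν ρ : Measure (EuclideanSpace ℝ (Fin d)))
    [IsProbabilityMeasure μ] [IsProbabilityMeasure ν] {s : ℝ} (hs : s ∈ Icc (0 : ℝ) 1) :
    ENNReal.ofReal (s * (1 - s)) * W2sq μ ν ≤
      ENNReal.ofReal (1 - s) * W2sq μ ρ + ENNReal.ofReal s * W2sq ν ρ := by
  -- At the endpoints the left-hand side vanishes; inside, both coefficients are positive and can be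
  -- moved into the infima even when `ρ` has no couplings with `μ` or `ν`.
  rcases hs.1.eq_or_lt with rfl | h0
  · simp
  rcases hs.2.eq_or_lt with rfl | h1
  · simp
  have e : ∀ α β : Measure (EuclideanSpace ℝ (Fin d)), ∀ c : ℝ, 0 < c →
      ENNReal.ofReal c * W2sq α β = ⨅ σ : {σ // IsCoupling α β σ},
        ENNReal.ofReal c * transportCost σ.1 := by
    intro α β c hc
    rw [W2sq, iInf_subtype', ENNReal.mul_iInf_of_ne (by simpa using hc) ENNReal.ofReal_ne_top]
  rw [e μ ρ _ (sub_pos.2 h1), e ν ρ _ h0]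
  exact ENNReal.le_iInf_add_iInf fun σ₁ σ₂ => convex_W2sq_le_transportCost hs σ₁.2 σ₂.2

theorem IsOptimalPlan.W2sq_mccann_snd_le {d : ℕ} {μ ν : Measure (EuclideanSpace ℝ (Fin d))}
    {π : Measure (EuclideanSpace ℝ (Fin d) × EuclideanSpace ℝ (Fin d))}
    (hπ : IsOptimalPlan μ ν π) (t : ℝ) :
    W2sq ν (mccann π t) ≤ ENNReal.ofReal ((1 - t) ^ 2) * W2sq μ ν := by
  have h := W2sq_mccann_le π 1 t
  rwa [mccann_one, hπ.1.2, hπ.2, sub_sq_comm] at h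

theorem IsOptimalPlan.W2sq_mccann_right {d : ℕ} {μ ν : Measure (EuclideanSpace ℝ (Fin d))}
    [IsProbabilityMeasure μ] [IsProbabilityMeasure ν]
    {π : Measure (EuclideanSpace ℝ (Fin d) × EuclideanSpace ℝ (Fin d))}
    (hπ : IsOptimalPlan μ ν π) (hfin : W2sq μ ν ≠ ∞) {t : ℝ} (ht : t ∈ Icc (0 : ℝ) 1) :
    W2sq μ (mccann π t) = ENNReal.ofReal (t ^ 2) * W2sq μ ν := by
  have hX : W2sq μ (mccann π t) ≤ ENNReal.ofReal (t ^ 2) * W2sq μ ν := by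
    have h := W2sq_mccann_le π 0 t
    rwa [mccann_zero, hπ.1.1, hπ.2, sub_zero] at h
  refine le_antisymm hX ?_
  rcases ht.2.eq_or_lt with rfl | h1
  · simp [mccann_one, hπ.1.2]
  -- For `t < 1` insert the upper bound for `W₂²(ν, (P_t)_# π)` into the gluing inequality with
  -- parameter `t` and cancel `1 - t`.
  have h := (convex_W2sq_le μ ν (mccann π t) ht).trans
    (add_le_add_right (mul_le_mul_right (hπ.W2sq_mccann_snd_le t) _) _)
  have hXfin : W2sq μ (mccann π t) ≠ ∞ :=
    ne_top_of_le_ne_top (ENNReal.mul_ne_top ENNReal.ofReal_ne_top hfin) hX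
  have h1' : 0 < 1 - t := sub_pos.2 h1
  have h0 : 0 ≤ t := ht.1
  rw [← ENNReal.ofReal_toReal hfin, ← ENNReal.ofReal_toReal hXfin] at h ⊢
  have hx : 0 ≤ (W2sq μ (mccann π t)).toReal := ENNReal.toReal_nonneg
  have ha : 0 ≤ (W2sq μ ν).toReal := ENNReal.toReal_nonneg
  generalize (W2sq μ (mccann π t)).toReal = x at *
  generalize (W2sq μ ν).toReal = a at *
  rw [← ENNReal.ofReal_mul (by positivity), ← ENNReal.ofReal_mul (by positivity),
    ← ENNReal.ofReal_mul (by positivity), ← ENNReal.ofReal_mul (by positivity),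
    ← ENNReal.ofReal_add (by positivity) (by positivity),
    ENNReal.ofReal_le_ofReal_iff (by positivity)] at h
  rw [← ENNReal.ofReal_mul (by positivity)]
  refine ENNReal.ofReal_le_ofReal (le_of_mul_le_mul_left ?_ h1')
  linarith

theorem W2sq_le_of_mem_mccannExtensions {d : ℕ} {μ ν α β : Measure (EuclideanSpace ℝ (Fin d))}
    (h : (α, β) ∈ mccannExtensions μ ν) : W2sq μ ν ≤ W2sq α β := by
  obtain ⟨-, -, γ, γ', hγ, hγ', a, b, ha, -, hb, hab⟩ := h
  obtain ⟨p, hp, hp'⟩ := hab 0 (by simp)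
  obtain ⟨q, hq, hq'⟩ := hab 1 (by simp)
  rw [mccann_zero, hγ.1.1] at hp'
  rw [mccann_one, hγ.1.2] at hq'
  have h := W2sq_mccann_le γ' p q
  rw [hp', hq', hγ'.2] at h
  have hpq : (q - p) ^ 2 ≤ 1 := by
    rw [sq_le_one_iff_abs_le_one, abs_le]
    constructor <;> linarith [hp.1, hp.2, hq.1, hq.2]
  exact h.trans (mul_le_of_le_one_left' (ENNReal.ofReal_le_one.2 hpq))

theorem geometricSparseRegularizer_pair {d : ℕ} (μ ν ρ : Measure (EuclideanSpace ℝ (Fin d)))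
    (t : Icc (0 : ℝ) 1) :
    geometricSparseRegularizer ![μ, ν] ![pairWeights t] ![ρ] =
      ENNReal.ofReal (1 - t) * W2sq μ ρ + ENNReal.ofReal t * W2sq ν ρ := by
  simp [geometricSparseRegularizer, pairWeights]

theorem theorem1 {d : ℕ} (μ ν ν' : Measure (EuclideanSpace ℝ (Fin d)))
    [IsProbabilityMeasure μ] [IsProbabilityMeasure ν] [IsProbabilityMeasure ν']
    (hfin : W2sq μ ν' ≠ ∞)
    (π π' : Measure (EuclideanSpace ℝ (Fin d) × EuclideanSpace ℝ (Fin d)))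
    (hπ : IsOptimalPlan μ ν π) (hπ' : IsOptimalPlan μ ν' π')
    (hM : (μ, ν') ∈ mccannExtensions μ ν)
    (t s : Icc (0 : ℝ) 1) (μt : Measure (EuclideanSpace ℝ (Fin d)))
    (ht : μt = mccann π t) (hs : μt = mccann π' s) :
    ENNReal.ofReal (1 - t) * W2sq μ μt + ENNReal.ofReal t * W2sq ν μt
        ≤ ENNReal.ofReal (1 - s) * W2sq μ μt + ENNReal.ofReal s * W2sq ν' μt ∧
      geometricSparseRegularizer ![μ, ν] ![pairWeights t] ![μt]
        ≤ geometricSparseRegularizer ![μ, ν'] ![pairWeights s] ![μt] := by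
  rw [geometricSparseRegularizer_pair, geometricSparseRegularizer_pair, and_self]
  have hAB := W2sq_le_of_mem_mccannExtensions hM
  have hAfin : W2sq μ ν ≠ ∞ := ne_top_of_le_ne_top hfin hAB
  have hXt := hπ.W2sq_mccann_right hAfin t.2
  have hXs := hπ'.W2sq_mccann_right hfin s.2
  have hY := hπ.W2sq_mccann_snd_le t
  rw [← ht] at hXt hY
  rw [← hs] at hXs
  refine le_trans ?_ (convex_W2sq_le μ ν' μt s.2)
  have h0 : 0 ≤ (t : ℝ) := t.2.1
  have h1 : 0 ≤ 1 - (t : ℝ) := sub_nonneg.2 t.2.2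
  have k0 : 0 ≤ (s : ℝ) := s.2.1
  have k1 : 0 ≤ 1 - (s : ℝ) := sub_nonneg.2 s.2.2
  refine (add_le_add_right (mul_le_mul_right hY _) _).trans ?_
  have hst := hXt.symm.trans hXs
  rw [hXt]
  rw [← ENNReal.ofReal_toReal hfin, ← ENNReal.ofReal_toReal hAfin] at hst hAB ⊢
  have ha : 0 ≤ (W2sq μ ν).toReal := ENNReal.toReal_nonneg
  have hb : 0 ≤ (W2sq μ ν').toReal := ENNReal.toReal_nonneg
  generalize (W2sq μ ν).toReal = A at *
  generalize (W2sq μ ν').toReal = B at *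
  rw [ENNReal.ofReal_le_ofReal_iff hb] at hAB
  rw [← ENNReal.ofReal_mul (by positivity), ← ENNReal.ofReal_mul (by positivity),
    ENNReal.ofReal_eq_ofReal_iff (by positivity) (by positivity)] at hst
  rw [← ENNReal.ofReal_mul (by positivity), ← ENNReal.ofReal_mul (by positivity),
    ← ENNReal.ofReal_mul (by positivity), ← ENNReal.ofReal_mul (by positivity),
    ← ENNReal.ofReal_mul (by positivity), ← ENNReal.ofReal_add (by positivity) (by positivity)]
  refine ENNReal.ofReal_le_ofReal ?_
  have key : (t : ℝ) * A ≤ s * B := by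
    refine (sq_le_sq₀ (by positivity) (by positivity)).1 ?_
    calc ((t : ℝ) * A) ^ 2 = (t ^ 2 * A) * A := by ring
      _ = (s ^ 2 * B) * A := by rw [hst]
      _ ≤ (s ^ 2 * B) * B := by gcongr
      _ = (s * B) ^ 2 := by ring
  linarith
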